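/- Let $\mathbf{x}=(x_i)_{i\in\mathbb{Z}}$, $\mathbf{y}=(y_j)_{j\in\mathbb{Z}}$ be commuting variables, $\mathbf{x}_-=(x_i)_{i\le 0}$, and put $a\ominus b=\frac{a-b}{1+\beta b}$. For a partition $\lambda$, identified with its Young diagram, let $\mathrm{SetSSYT}(\lambda)$ be the set of fillings $T$ of the cells $(r,c)\in\lambda$ with non-empty finite sets of integers such that $\max T(r,c)\le \min T(r,c+1)$ and $\max T(r,c)<\min T(r+1,c)$ whenever both cells lie in $\lambda$, and let $$\mathrm{wt}(T)=\beta^{-|\lambda|}\prod_{(r,c)\in\lambda}\ \prod_{i\in T(r,c)}\beta\,(x_i\ominus y_{i+c-r}).$$ A flag is a weakly increasing sequence $\phi=(\phi_1\le\phi_2\le\dots)$ of integers (only the first $\ell(\lambda)$ entries matter for $\lambda$). As formal power series in $\mathbf{x},\mathbf{y}$ over the field $\mathbb{Z}(\beta)$ of rational functions, put $$G^\phi_\lambda(\beta;\mathbf{x};\mathbf{y})=\sum_{T}\mathrm{wt}(T),$$ the sum over $T\in\mathrm{SetSSYT}(\lambda)$ with $\max T(r,c)\le\phi_r$ for all $(r,c)\in\lambda$,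 and $$G_\lambda(\beta;\mathbf{x}_-;\mathbf{y})=\sum_{T}\mathrm{wt}(T),$$ the sum over $T\in\mathrm{SetSSYT}(\lambda)$ all of whose entries are sets of non-positive integers. Let $R(\beta;\mathbf{x};\mathbf{y})=\mathbb{Z}(\beta)\left[x_i,y_i,\tfrac1{1+\beta x_i},\tfrac1{1+\beta y_i}: i\in\mathbb{Z}\right]$. Call $\lambda$ and $\phi$ compatible if $\phi_{i+1}-\phi_i\le\lambda_i-\lambda_{i+1}+1$ for $1\le i\le\ell(\lambda)$, where a flag of length $\ell(\lambda)$ is continued by repeating its last entry. Let $a^{\lambda,\phi}_\mu(\beta;\mathbf{x};\mathbf{y})\in R(\beta;\mathbf{x};\mathbf{y})$ be the coefficients of the finite expansion $$G^\phi_\lambda(\beta;\mathbf{x};\mathbf{y})=\sum_\mu a^{\lambda,\phi}_\mu(\beta;\mathbf{x};\mathbf{y})\,G_\mu(\beta;\mathbf{x}_-;\mathbf{y}),$$ and let $j^{\lambda,\phi}_\mu(\beta;\mathbf{y})$ be the image of $a^{\lambda,\phi}_\mu(\beta;\mathbf{x};\mathbf{y})$ under $x_i\mapsto y_i$ for all $i\in\mathbb{Z}$.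 Let $\phi^+_i=\max(\phi_i,0)$ and $\phi^-_i=\min(\phi_i,0)$. Proposition. Suppose that the partition $\lambda$ and the flag $\phi$ are compatible. Then $$G^{\phi}_{\lambda}(\beta;\mathbf{x};\mathbf{y})=\sum_{\nu\subseteq\lambda}G^{\phi^-}_{\nu}(\beta;\mathbf{x};\mathbf{y})\,a^{\lambda,\phi^+}_\nu(\beta;\mathbf{x};\mathbf{y}).$$ Consequently, for every partition $\rho$, $$a^{\lambda,\phi}_\rho(\beta;\mathbf{x};\mathbf{y})=\sum_{\nu\subseteq\lambda}a^{\nu,\phi^-}_{\rho}(\beta;\mathbf{x};\mathbf{y})\,a^{\lambda,\phi^+}_\nu(\beta;\mathbf{x};\mathbf{y}),$$ and, setting $\mathbf{x}\mapsto\mathbf{y}$, $$j^{\lambda,\phi}_\rho(\beta;\mathbf{y})=\sum_{\nu\subseteq\lambda}j^{\nu,\phi^-}_{\rho}(\beta;\mathbf{y})\,j^{\lambda,\phi^+}_\nu(\beta;\mathbf{y}).$$ Here all notation is meaningful: $\lambda$ and $\phi^+$ are compatible; $\nu$ and $\phi^-$ are compatible for every $\nu\subseteq\lambda$ with $a^{\lambda,\phi^+}_\nu\ne0$;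 and for each of the pairs $(\lambda,\phi)$, $(\lambda,\phi^+)$ and these $(\nu,\phi^-)$ the expansion that defines the coefficients exists and is unique. -/

import Mathlib

/-!
# Flagged double stable `β`-Grothendieck functions

Rows and columns are numbered from `0`, so row `r` and column `c` below are row `r + 1` and
column `c + 1` in the usual numbering; the content `c - r` of a cell is the same in both.
-/

namespace BetaGrothendieck

noncomputable section

/-- The coefficient field `ℤ(β)`, the field of fractions of `ℤ[β]`. -/
abbrev K : Type := RatFunc ℤ

/-- The parameter `β`. -/
def β : K := RatFunc.X

/-- Formal power series over `ℤ(β)` in the variables `x_i` and `y_j`, for integers `i` and `j`. -/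
abbrev Series : Type := MvPowerSeries (ℤ ⊕ ℤ) K

/-- The variable `x_i`. -/
def x (i : ℤ) : Series := MvPowerSeries.X (Sum.inl i)

/-- The variable `y_j`. -/
def y (j : ℤ) : Series := MvPowerSeries.X (Sum.inr j)

/-- `a ⊖ b = (a - b) / (1 + β b)`. It is used only where `b` is a variable, and then `1 + β b` is
an invertible power series, with inverse `∑ (-β b) ^ k`. -/
def ominus (a b : Series) : Series := (a - b) * (1 + MvPowerSeries.C β * b)⁻¹

/-- Semistandard tableaux of shape `lam` whose entries are non-empty finite sets of integers.
Positions outside the diagram carry the empty set. -/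
@[ext]
structure SetSSYT (lam : YoungDiagram) where
  /-- The set in row `r` and column `c`. -/
  entry : ℕ → ℕ → Finset ℤ
  nonempty_iff : ∀ r c, (entry r c).Nonempty ↔ (r, c) ∈ lam
  /-- The maximum of a cell is at most the minimum of its right neighbour. -/
  row_weak : ∀ r c, ∀ i ∈ entry r c, ∀ j ∈ entry r (c + 1), i ≤ j
  /-- The maximum of a cell is less than the minimum of the cell below it. -/
  col_strict : ∀ r c, ∀ i ∈ entry r c, ∀ j ∈ entry (r + 1) c, i < j

/-- The weight `β ^ (-|lam|) * ∏_{(r, c)} ∏_{i ∈ T(r, c)} β (x_i ⊖ y_{i + c - r})`. -/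
def SetSSYT.wt {lam : YoungDiagram} (T : SetSSYT lam) : Series :=
  MvPowerSeries.C ((β⁻¹) ^ lam.card) *
    ∏ p ∈ lam.cells, ∏ i ∈ T.entry p.1 p.2,
      MvPowerSeries.C β * ominus (x i) (y (i + (p.2 : ℤ) - (p.1 : ℤ)))

/-- The tableaux in which no entry of row `r` exceeds `φ r`. -/
def flagged (lam : YoungDiagram) (φ : ℕ → ℤ) : Set (SetSSYT lam) :=
  {T | ∀ r c, ∀ i ∈ T.entry r c, i ≤ φ r}

/-- The tableaux with entries in the non-positive integers. -/
def nonPos (lam : YoungDiagram) : Set (SetSSYT lam) :=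
  {T | ∀ r c, ∀ i ∈ T.entry r c, i ≤ 0}

/-- The formal sum of the weights of the tableaux in `P`, taken coefficient by coefficient. -/
def weightSum {lam : YoungDiagram} (P : Set (SetSSYT lam)) : Series :=
  fun m => ∑ᶠ T ∈ P, MvPowerSeries.coeff m T.wt

/-- The double stable `β`-Grothendieck function `G_lam(β; x_-; y)`. -/
def G (lam : YoungDiagram) : Series := weightSum (nonPos lam)

/-- The flagged double stable `β`-Grothendieck function `G^φ_lam(β; x; y)`. -/
def flaggedG (lam : YoungDiagram) (φ : ℕ → ℤ) : Series := weightSum (flagged lam φ)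

/-- The partition `lam` and the flag `φ` are compatible: `φ` is weakly increasing and
`φ_{i+1} - φ_i ≤ lam_i - lam_{i+1} + 1` for each row `i` of `lam`. A flag `φ_1 ≤ … ≤ φ_ℓ`, with
`ℓ` the length of `lam`, is continued by `φ_ℓ` to an infinite sequence: the inequality then holds
in the last row, and nothing else depends on the continuation. -/
structure Compatible (lam : YoungDiagram) (φ : ℕ → ℤ) : Prop where
  flag : Monotone φ
  gap : ∀ i < lam.colLen 0, φ (i + 1) - φ i ≤ (lam.rowLen i : ℤ) - (lam.rowLen (i + 1) : ℤ) + 1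

/-- The flag `φ⁺`, with `φ⁺_i = max (φ_i) 0`. -/
def flagPos (φ : ℕ → ℤ) : ℕ → ℤ := fun i => max (φ i) 0

/-- The flag `φ⁻`, with `φ⁻_i = min (φ_i) 0`. -/
def flagNeg (φ : ℕ → ℤ) : ℕ → ℤ := fun i => min (φ i) 0

/-- The ring `R(β; x; y)`, generated over `ℤ(β)` by all `x_i`, `y_j`, `1 / (1 + β x_i)` and
`1 / (1 + β y_j)`. -/
def R : Subalgebra K Series :=
  Algebra.adjoin K
    (Set.range (fun s => (MvPowerSeries.X s : Series)) ∪
      Set.range (fun s => (1 + MvPowerSeries.C β * (MvPowerSeries.X s : Series))⁻¹))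

/-- `a` is a family of coefficients, almost all zero, of an expansion
`f = ∑_μ a_μ(β; x; y) * G_μ(β; x_-; y)` with all `a_μ` in `R(β; x; y)`. -/
def IsExpansion (f : Series) (a : YoungDiagram →₀ R) : Prop :=
  f = a.sum fun μ c => (c : Series) * G μ

open Classical in
/-- The coefficients `a^{lam,φ}_μ(β; x; y)` of the expansion
`G^φ_lam(β; x; y) = ∑_μ a^{lam,φ}_μ(β; x; y) * G_μ(β; x_-; y)` (zero if there is none). -/
def aCoeff (lam : YoungDiagram) (φ : ℕ → ℤ) : YoungDiagram →₀ R :=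
  if h : ∃ a, IsExpansion (flaggedG lam φ) a then h.choose else 0

/-- The map of variables that sends both `x_i` and `y_i` to `y_i`. -/
def xyIndex : ℤ ⊕ ℤ → ℤ := Sum.elim id id

instance : Filter.TendstoCofinite xyIndex where
  tendsto_cofinite := by
    refine Filter.Tendsto.cofinite_of_finite_preimage_singleton fun j => ?_
    refine (Set.toFinite ({Sum.inl j, Sum.inr j} : Set (ℤ ⊕ ℤ))).subset ?_
    rintro (i | i) hi
    · left; exact congrArg Sum.inl hi
    · right; exact congrArg Sum.inr hi

/-- The substitution `x ↦ y`, with values in the power series in the variables `y_j`. -/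
def xToY : Series →ₐ[K] MvPowerSeries ℤ K := MvPowerSeries.rename xyIndex

/-- `j^{lam,φ}_μ(β; y)`, the image of `a^{lam,φ}_μ(β; x; y)` under `x ↦ y`. -/
def jCoeff (lam : YoungDiagram) (φ : ℕ → ℤ) (μ : YoungDiagram) : MvPowerSeries ℤ K :=
  xToY (aCoeff lam φ μ : Series)

theorem finite_subdiagrams (lam : YoungDiagram) : {ν : YoungDiagram | ν ≤ lam}.Finite := by
  refine Set.Finite.of_finite_image (f := YoungDiagram.cells) ?_ ?_
  · refine (lam.cells.powerset.finite_toSet).subset ?_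
    rintro _ ⟨ν, hν, rfl⟩
    exact Finset.mem_coe.2 (Finset.mem_powerset.2 hν)
  · intro a _ b _ h
    exact YoungDiagram.ext h

/-- The partitions `ν ⊆ lam`. -/
def subdiagrams (lam : YoungDiagram) : Finset YoungDiagram := (finite_subdiagrams lam).toFinset

/-- Every coefficient of the formal sum `weightSum P` is a finite sum. -/
theorem finite_support_coeff_wt (lam : YoungDiagram) (m : (ℤ ⊕ ℤ) →₀ ℕ) :
    {T : SetSSYT lam | MvPowerSeries.coeff m T.wt ≠ 0}.Finite := by
  classical
  -- the only entries that can occur in row `r` and column `c`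
  let E : ℕ → ℕ → Finset ℤ := fun r c =>
    m.support.image (Sum.elim id fun j => j - (c : ℤ) + (r : ℤ))
  have key : ∀ T : SetSSYT lam, MvPowerSeries.coeff m T.wt ≠ 0 →
      ∀ r c, T.entry r c ⊆ E r c := by
    intro T hT r c i hi
    have hmem : (r, c) ∈ lam.cells := (T.nonempty_iff r c).1 ⟨i, hi⟩
    by_contra hE
    apply hT
    have h1 : m (Sum.inl i) = 0 := by
      by_contra h
      exact hE (Finset.mem_image.2 ⟨Sum.inl i, Finsupp.mem_support_iff.2 h, rfl⟩)
    have h2 : m (Sum.inr (i + (c : ℤ) - (r : ℤ))) = 0 := by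
      by_contra h
      exact hE (Finset.mem_image.2
        ⟨Sum.inr (i + (c : ℤ) - (r : ℤ)), Finsupp.mem_support_iff.2 h, by simp only [Sum.elim_inr]; ring⟩)
    have hX : ∀ (s : ℤ ⊕ ℤ), m s = 0 → ∀ g : Series,
        MvPowerSeries.coeff m (MvPowerSeries.X s * g) = 0 := by
      intro s hs g
      exact MvPowerSeries.X_dvd_iff.1 (Dvd.intro _ rfl) m hs
    have hdvd : ominus (x i) (y (i + (c : ℤ) - (r : ℤ))) ∣ T.wt := by
      unfold SetSSYT.wt
      refine Dvd.dvd.mul_left ?_ _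
      refine Dvd.dvd.trans ?_ (Finset.dvd_prod_of_mem _ hmem)
      refine Dvd.dvd.trans ?_ (Finset.dvd_prod_of_mem _ hi)
      exact Dvd.intro_left _ rfl
    obtain ⟨g, hg⟩ := hdvd
    rw [hg, ominus, mul_assoc, sub_mul, map_sub, x, y, hX _ h1, hX _ h2, sub_zero]
  let B : Finset (ℕ × ℕ → Finset ℤ) :=
    (lam.cells.pi fun p => (E p.1 p.2).powerset).image fun f p =>
      if h : p ∈ lam.cells then f p h else ∅
  refine Set.Finite.of_finite_image (f := fun T : SetSSYT lam => fun p : ℕ × ℕ => T.entry p.1 p.2)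
    ((B.finite_toSet).subset ?_) ?_
  · rintro _ ⟨T, hT, rfl⟩
    refine Finset.mem_coe.2 (Finset.mem_image.2 ⟨fun p _ => T.entry p.1 p.2, ?_, ?_⟩)
    · exact Finset.mem_pi.2 fun p _ => Finset.mem_powerset.2 (key T hT p.1 p.2)
    · funext p
      by_cases h : p ∈ lam.cells
      · simp [h]
      · have : ¬ (T.entry p.1 p.2).Nonempty := fun hn => h ((T.nonempty_iff p.1 p.2).1 hn)
        simp only [h, dite_false]
        exact (Finset.not_nonempty_iff_eq_empty.1 this).symm
  · intro T _ T' _ h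
    ext1
    funext r c
    exact congrFun h (r, c)

end

end BetaGrothendieck

namespace BetaGrothendieck

noncomputable section

/-! Cut a tableau of shape `lam` at a threshold `m`. Its entries at most `m` form a tableau of some
shape `ν ⊆ lam`; the entries above `m` form a finite set of boxes, and a cell may contribute to both
parts. The conditions that link the two parts depend on `ν` alone, so lower and upper parts combine
freely. This gives `flaggedG_eq_sum`: `flaggedG lam φ` is the sum over `ν` of `flaggedG ν (min φ m)`
times a finite sum `upperSum lam ν m φ` in `R`.

For `m = 0` and the flag `φ⁺` the lower factor is `G ν`, so by uniqueness the upper factor is the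
coefficient `a^{lam,φ⁺}_ν` (`aCoeff_flagPos`). The flags `φ` and `φ⁺` allow the same positive boxes,
so cutting at `0` under `φ` gives the first identity. Expanding each `flaggedG ν φ⁻` and comparing
coefficients gives the second, and the ring homomorphism `xToY` the third.

Existence of expansions (`flaggedG_mem_GSpan`) uses the same formula at negative thresholds: there
it is a triangular system whose diagonal entries are invertible in `R`. Uniqueness
(`linearIndependent_G`) holds because an element of `R` involves finitely many variables, while the
`G μ` can be separated by monomials in `x_i` with `i` very negative, triangularly with respect to
`rowSum`. -/

/-! ### Tableaux as sets of boxes -/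

/-- An entry of a tableau together with its cell. -/
abbrev Box : Type := (_ : ℕ × ℕ) × ℤ

/-- The factor that a box contributes to the weight of a tableau. -/
def boxWt (q : Box) : Series :=
  MvPowerSeries.C β * ominus (x q.2) (y (q.2 + (q.1.2 : ℤ) - (q.1.1 : ℤ)))

/-- The boxes of a tableau. -/
def SetSSYT.boxes {lam : YoungDiagram} (T : SetSSYT lam) : Finset Box :=
  lam.cells.sigma fun p => T.entry p.1 p.2

theorem β_ne_zero : β ≠ 0 :=
  (map_ne_zero_iff _ (IsFractionRing.injective (Polynomial ℤ) K)).2 Polynomial.X_ne_zero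

theorem SetSSYT.mem_of_mem_entry {lam : YoungDiagram} (T : SetSSYT lam) {r c : ℕ} {i : ℤ}
    (h : i ∈ T.entry r c) : (r, c) ∈ lam := (T.nonempty_iff r c).1 ⟨i, h⟩

@[simp]
theorem SetSSYT.mem_boxes {lam : YoungDiagram} (T : SetSSYT lam) {q : Box} :
    q ∈ T.boxes ↔ q.2 ∈ T.entry q.1.1 q.1.2 := by
  simp only [boxes, Finset.mem_sigma, YoungDiagram.mem_cells, and_iff_right_iff_imp]
  exact fun h => T.mem_of_mem_entry h

theorem SetSSYT.wt_eq {lam : YoungDiagram} (T : SetSSYT lam) :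
    T.wt = MvPowerSeries.C ((β⁻¹) ^ lam.card) * ∏ q ∈ T.boxes, boxWt q := by
  rw [wt, boxes, Finset.prod_sigma]
  rfl

theorem SetSSYT.boxes_injective {lam : YoungDiagram} :
    Function.Injective (boxes : SetSSYT lam → Finset Box) := by
  intro T T' h
  ext r c i
  have := Finset.ext_iff.1 h ⟨(r, c), i⟩
  simpa using this

theorem SetSSYT.exists_le_of_right {lam : YoungDiagram} (T : SetSSYT lam) {r c : ℕ} {i : ℤ} (d : ℕ)
    (h : i ∈ T.entry r (c + d)) : ∃ j ∈ T.entry r c, j ≤ i := by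
  induction d generalizing i with
  | zero => exact ⟨i, h, le_rfl⟩
  | succ d ih =>
    have hm := lam.up_left_mem le_rfl (Nat.le_succ (c + d)) (T.mem_of_mem_entry h)
    obtain ⟨k, hk⟩ := (T.nonempty_iff _ _).2 hm
    obtain ⟨j, hj, hjk⟩ := ih hk
    exact ⟨j, hj, hjk.trans (T.row_weak r (c + d) k hk i h)⟩

theorem SetSSYT.exists_le_of_below {lam : YoungDiagram} (T : SetSSYT lam) {r c : ℕ} {i : ℤ} (d : ℕ)
    (h : i ∈ T.entry (r + d) c) : ∃ j ∈ T.entry r c, j + d ≤ i := by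
  induction d generalizing i with
  | zero => exact ⟨i, h, by simp⟩
  | succ d ih =>
    have hm := lam.up_left_mem (Nat.le_succ (r + d)) le_rfl (T.mem_of_mem_entry h)
    obtain ⟨k, hk⟩ := (T.nonempty_iff _ _).2 hm
    obtain ⟨j, hj, hjk⟩ := ih hk
    have := T.col_strict (r + d) c k hk i h
    exact ⟨j, hj, by push_cast; omega⟩

theorem mem_subdiagrams {lam ν : YoungDiagram} : ν ∈ subdiagrams lam ↔ ν ≤ lam := by
  simp [subdiagrams]

/-! ### Splitting a tableau at a threshold -/

/-- `U` is the set of boxes above a threshold in a tableau of shape `lam` whose boxes at or below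
the threshold form a tableau of shape `ν`. -/
structure IsUpper (lam ν : YoungDiagram) (U : Finset Box) : Prop where
  row_weak : ∀ r c i j, (⟨(r, c), i⟩ : Box) ∈ U → (⟨(r, c + 1), j⟩ : Box) ∈ U → i ≤ j
  col_strict : ∀ r c i j, (⟨(r, c), i⟩ : Box) ∈ U → (⟨(r + 1, c), j⟩ : Box) ∈ U → i < j
  covers : ∀ p ∈ lam, p ∉ ν → ∃ i, (⟨p, i⟩ : Box) ∈ U
  -- These last two fields are the only conditions across the threshold: a cell of `ν` has an entry
  -- at or below it, which cannot stand to the right of or below a larger one.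
  right : ∀ r c i, (⟨(r, c), i⟩ : Box) ∈ U → (r, c + 1) ∉ ν
  below : ∀ r c i, (⟨(r, c), i⟩ : Box) ∈ U → (r + 1, c) ∉ ν

/-- The boxes of `lam` with entries greater than `m` that are allowed by the flag `φ`. -/
def upperBoxes (lam : YoungDiagram) (m : ℤ) (φ : ℕ → ℤ) : Finset Box :=
  lam.cells.sigma fun p => Finset.Ioc m (φ p.1)

theorem mem_upperBoxes {lam : YoungDiagram} {m : ℤ} {φ : ℕ → ℤ} {q : Box} :
    q ∈ upperBoxes lam m φ ↔ q.1 ∈ lam ∧ m < q.2 ∧ q.2 ≤ φ q.1.1 := by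
  simp [upperBoxes]

open Classical in
/-- The sets of boxes above the threshold `m` in the tableaux that are flagged by `φ`. -/
def uppers (lam ν : YoungDiagram) (m : ℤ) (φ : ℕ → ℤ) : Finset (Finset Box) :=
  (upperBoxes lam m φ).powerset.filter (IsUpper lam ν)

theorem mem_uppers {lam ν : YoungDiagram} {m : ℤ} {φ : ℕ → ℤ} {U : Finset Box} :
    U ∈ uppers lam ν m φ ↔ U ⊆ upperBoxes lam m φ ∧ IsUpper lam ν U := by
  simp [uppers]

/-- The sum of the weights of the parts above `m`, complementary to tableaux of shape `ν`. -/
def upperSum (lam ν : YoungDiagram) (m : ℤ) (φ : ℕ → ℤ) : Series :=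
  -- The scalar replaces the normalization `β ^ (-|ν|)` in the weight of the lower tableau by `β ^
  -- (-|lam|)`.
  MvPowerSeries.C (β ^ ν.card * (β⁻¹) ^ lam.card) *
    ∑ U ∈ uppers lam ν m φ, ∏ q ∈ U, boxWt q

/-- The tableau with boxes at or below `m` those of `S` and boxes above `m` those in `U`. -/
def glue {lam ν : YoungDiagram} {m : ℤ} {φ : ℕ → ℤ} (hν : ν ≤ lam) {U : Finset Box}
    (hU : U ∈ uppers lam ν m φ) (S : SetSSYT ν) (hS : ∀ r c, ∀ i ∈ S.entry r c, i ≤ m) :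
    SetSSYT lam where
  entry r c := S.entry r c ∪ (U.filter fun q => q.1 = (r, c)).image Sigma.snd
  nonempty_iff r c := by
    obtain ⟨h1, h2⟩ := mem_uppers.1 hU
    constructor
    · rintro ⟨i, hi⟩
      rw [Finset.mem_union] at hi
      rcases hi with hi | hi
      · exact hν (S.mem_of_mem_entry hi)
      · obtain ⟨q, hq, rfl⟩ := Finset.mem_image.1 hi
        obtain ⟨hq, hq'⟩ := Finset.mem_filter.1 hq
        exact hq' ▸ (mem_upperBoxes.1 (h1 hq)).1
    · intro h
      by_cases hc : (r, c) ∈ ν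
      · obtain ⟨i, hi⟩ := (S.nonempty_iff r c).2 hc
        exact ⟨i, Finset.mem_union_left _ hi⟩
      · obtain ⟨i, hi⟩ := h2.covers _ h hc
        exact ⟨i, Finset.mem_union_right _
          (Finset.mem_image.2 ⟨_, Finset.mem_filter.2 ⟨hi, rfl⟩, rfl⟩)⟩
  row_weak r c i hi j hj := by
    obtain ⟨h1, h2⟩ := mem_uppers.1 hU
    simp only [Finset.mem_union, Finset.mem_image, Finset.mem_filter] at hi hj
    rcases hi with hi | ⟨⟨_, i⟩, ⟨hi, rfl⟩, rfl⟩ <;> rcases hj with hj | ⟨⟨_, j⟩, ⟨hj, rfl⟩, rfl⟩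
    · exact S.row_weak r c i hi j hj
    · exact (hS r c i hi).trans (mem_upperBoxes.1 (h1 hj)).2.1.le
    · exact absurd (S.mem_of_mem_entry hj) (h2.right _ _ _ hi)
    · exact h2.row_weak _ _ _ _ hi hj
  col_strict r c i hi j hj := by
    obtain ⟨h1, h2⟩ := mem_uppers.1 hU
    simp only [Finset.mem_union, Finset.mem_image, Finset.mem_filter] at hi hj
    rcases hi with hi | ⟨⟨_, i⟩, ⟨hi, rfl⟩, rfl⟩ <;> rcases hj with hj | ⟨⟨_, j⟩, ⟨hj, rfl⟩, rfl⟩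
    · exact S.col_strict r c i hi j hj
    · exact (hS r c i hi).trans_lt (mem_upperBoxes.1 (h1 hj)).2.1
    · exact absurd (S.mem_of_mem_entry hj) (h2.below _ _ _ hi)
    · exact h2.col_strict _ _ _ _ hi hj

theorem boxes_glue {lam ν : YoungDiagram} {m : ℤ} {φ : ℕ → ℤ} (hν : ν ≤ lam) {U : Finset Box}
    (hU : U ∈ uppers lam ν m φ) (S : SetSSYT ν) (hS : ∀ r c, ∀ i ∈ S.entry r c, i ≤ m) :
    (glue hν hU S hS).boxes = S.boxes ∪ U := by
  ext ⟨⟨r, c⟩, i⟩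
  simp only [SetSSYT.mem_boxes, glue, Finset.mem_union, Finset.mem_image, Finset.mem_filter]
  refine or_congr Iff.rfl ⟨?_, fun h => ⟨_, ⟨h, rfl⟩, rfl⟩⟩
  rintro ⟨⟨_, i⟩, ⟨hi, rfl⟩, rfl⟩
  exact hi

theorem wt_glue {lam ν : YoungDiagram} {m : ℤ} {φ : ℕ → ℤ} (hν : ν ≤ lam) {U : Finset Box}
    (hU : U ∈ uppers lam ν m φ) (S : SetSSYT ν) (hS : ∀ r c, ∀ i ∈ S.entry r c, i ≤ m) :
    (glue hν hU S hS).wt =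
      S.wt * (MvPowerSeries.C (β ^ ν.card * (β⁻¹) ^ lam.card) * ∏ q ∈ U, boxWt q) := by
  have hd : Disjoint S.boxes U := by
    refine Finset.disjoint_left.2 fun q hq hq' => ?_
    exact absurd (hS _ _ _ (S.mem_boxes.1 hq))
      (mem_upperBoxes.1 ((mem_uppers.1 hU).1 hq')).2.1.not_ge
  have hβ : (β⁻¹) ^ lam.card = (β⁻¹) ^ ν.card * (β ^ ν.card * (β⁻¹) ^ lam.card) := by
    rw [← mul_assoc, ← mul_pow, inv_mul_cancel₀ β_ne_zero, one_pow, one_mul]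
  rw [SetSSYT.wt_eq, SetSSYT.wt_eq, boxes_glue, Finset.prod_union hd]
  nth_rewrite 1 [hβ]
  rw [map_mul]
  ring

/-- The cells with an entry at most `m`. -/
def lowerShape {lam : YoungDiagram} (T : SetSSYT lam) (m : ℤ) : YoungDiagram where
  cells := lam.cells.filter fun p => ∃ i ∈ T.entry p.1 p.2, i ≤ m
  isLowerSet := by
    rintro ⟨r, c⟩ ⟨r', c'⟩ ⟨hr, hc⟩ h
    simp only [Finset.coe_filter, Set.mem_ofPred_eq, YoungDiagram.mem_cells] at h ⊢
    obtain ⟨h, i, hi, him⟩ := h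
    obtain ⟨d, rfl⟩ := Nat.exists_eq_add_of_le (show r' ≤ r from hr)
    obtain ⟨e, rfl⟩ := Nat.exists_eq_add_of_le (show c' ≤ c from hc)
    obtain ⟨j, hj, hji⟩ := T.exists_le_of_right e hi
    obtain ⟨k, hk, hkj⟩ := T.exists_le_of_below d hj
    exact ⟨T.mem_of_mem_entry hk, k, hk, by omega⟩

theorem mem_lowerShape {lam : YoungDiagram} {T : SetSSYT lam} {m : ℤ} {p : ℕ × ℕ} :
    p ∈ lowerShape T m ↔ ∃ i ∈ T.entry p.1 p.2, i ≤ m := by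
  rw [← YoungDiagram.mem_cells]
  simp only [lowerShape, Finset.mem_filter, and_iff_right_iff_imp]
  rintro ⟨i, hi, -⟩
  exact T.mem_of_mem_entry hi

/-- The part of a tableau at or below `m`. -/
def lowerPart {lam : YoungDiagram} (T : SetSSYT lam) (m : ℤ) : SetSSYT (lowerShape T m) where
  entry r c := (T.entry r c).filter (· ≤ m)
  nonempty_iff r c := by simp [mem_lowerShape, Finset.Nonempty]
  row_weak r c i hi j hj :=
    T.row_weak r c i (Finset.mem_filter.1 hi).1 j (Finset.mem_filter.1 hj).1
  col_strict r c i hi j hj :=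
    T.col_strict r c i (Finset.mem_filter.1 hi).1 j (Finset.mem_filter.1 hj).1

/-- The boxes of a tableau above `m`. -/
def upperPart {lam : YoungDiagram} (T : SetSSYT lam) (m : ℤ) : Finset Box :=
  T.boxes.filter fun q => m < q.2

theorem mem_upperPart {lam : YoungDiagram} {T : SetSSYT lam} {m : ℤ} {q : Box} :
    q ∈ upperPart T m ↔ q.2 ∈ T.entry q.1.1 q.1.2 ∧ m < q.2 := by
  simp [upperPart]

theorem upperPart_mem_uppers {lam : YoungDiagram} {φ : ℕ → ℤ} {T : SetSSYT lam}
    (hT : T ∈ flagged lam φ) (m : ℤ) : upperPart T m ∈ uppers lam (lowerShape T m) m φ := by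
  refine mem_uppers.2 ⟨fun q hq => ?_, ?_, ?_, ?_, ?_, ?_⟩
  · obtain ⟨h1, h2⟩ := mem_upperPart.1 hq
    exact mem_upperBoxes.2 ⟨T.mem_of_mem_entry h1, h2, hT _ _ _ h1⟩
  · exact fun r c i j hi hj => T.row_weak r c i (mem_upperPart.1 hi).1 j (mem_upperPart.1 hj).1
  · exact fun r c i j hi hj => T.col_strict r c i (mem_upperPart.1 hi).1 j (mem_upperPart.1 hj).1
  · rintro ⟨r, c⟩ hp hp'
    obtain ⟨i, hi⟩ := (T.nonempty_iff r c).2 hp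
    refine ⟨i, mem_upperPart.2 ⟨hi, ?_⟩⟩
    by_contra h
    exact hp' (mem_lowerShape.2 ⟨i, hi, not_lt.1 h⟩)
  · intro r c i hi h
    obtain ⟨h1, h2⟩ := mem_upperPart.1 hi
    obtain ⟨j, hj, hjm⟩ := mem_lowerShape.1 h
    exact absurd (T.row_weak r c i h1 j hj) (by simp only at h2; omega)
  · intro r c i hi h
    obtain ⟨h1, h2⟩ := mem_upperPart.1 hi
    obtain ⟨j, hj, hjm⟩ := mem_lowerShape.1 h
    exact absurd (T.col_strict r c i h1 j hj) (by simp only at h2; omega)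

theorem boxes_lowerPart_union_upperPart {lam : YoungDiagram} (T : SetSSYT lam) (m : ℤ) :
    (lowerPart T m).boxes ∪ upperPart T m = T.boxes := by
  ext q
  simp only [Finset.mem_union, SetSSYT.mem_boxes, lowerPart, mem_upperPart, Finset.mem_filter,
    ← and_or_left, and_iff_left (le_or_gt q.2 m)]

theorem lowerShape_glue {lam ν : YoungDiagram} {m : ℤ} {φ : ℕ → ℤ} (hν : ν ≤ lam) {U : Finset Box}
    (hU : U ∈ uppers lam ν m φ) (S : SetSSYT ν) (hS : ∀ r c, ∀ i ∈ S.entry r c, i ≤ m) :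
    lowerShape (glue hν hU S hS) m = ν := by
  refine YoungDiagram.ext (Finset.ext ?_)
  rintro ⟨r, c⟩
  simp only [YoungDiagram.mem_cells, mem_lowerShape]
  constructor
  · rintro ⟨i, hi, him⟩
    have : (⟨(r, c), i⟩ : Box) ∈ (glue hν hU S hS).boxes := (SetSSYT.mem_boxes _).2 hi
    rw [boxes_glue, Finset.mem_union] at this
    rcases this with h | h
    · exact S.mem_of_mem_entry (S.mem_boxes.1 h)
    · exact absurd him (mem_upperBoxes.1 ((mem_uppers.1 hU).1 h)).2.1.not_ge
  · intro h
    obtain ⟨i, hi⟩ := (S.nonempty_iff r c).2 h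
    exact ⟨i, Finset.mem_union_left _ hi, hS _ _ _ hi⟩

theorem upperPart_glue {lam ν : YoungDiagram} {m : ℤ} {φ : ℕ → ℤ} (hν : ν ≤ lam) {U : Finset Box}
    (hU : U ∈ uppers lam ν m φ) (S : SetSSYT ν) (hS : ∀ r c, ∀ i ∈ S.entry r c, i ≤ m) :
    upperPart (glue hν hU S hS) m = U := by
  ext q
  rw [upperPart, boxes_glue, Finset.mem_filter, Finset.mem_union]
  constructor
  · rintro ⟨h | h, hm⟩
    · exact absurd (hS _ _ _ (S.mem_boxes.1 h)) hm.not_ge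
    · exact h
  · exact fun h => ⟨Or.inr h, (mem_upperBoxes.1 ((mem_uppers.1 hU).1 h)).2.1⟩

/-! ### The splitting formula -/

section Topology

open scoped MvPowerSeries.WithPiTopology

local instance : TopologicalSpace K := ⊥

local instance : DiscreteTopology K := ⟨rfl⟩

/-- With the discrete topology on `K`, the coefficientwise finite sums become a genuine `HasSum` for
the product topology, which can be regrouped and multiplied by a fixed series. -/
theorem hasSum_weightSum {lam : YoungDiagram} (P : Set (SetSSYT lam)) :
    HasSum (fun T : P => (T : SetSSYT lam).wt) (weightSum P) := by
  rw [MvPowerSeries.WithPiTopology.hasSum_iff_hasSum_coeff]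
  intro m
  have hfin : (Function.support fun T : P => MvPowerSeries.coeff m (T : SetSSYT lam).wt).Finite :=
    (finite_support_coeff_wt lam m).preimage Subtype.val_injective.injOn
  have := hasSum_sum_of_ne_finset_zero (L := SummationFilter.unconditional _) (f := fun T : P => MvPowerSeries.coeff m (T : SetSSYT lam).wt)
    (s := hfin.toFinset) (fun T hT => by simpa using hT)
  rwa [← finsum_eq_sum _ hfin, finsum_set_coe_eq_finsum_mem (f := fun T => MvPowerSeries.coeff m (SetSSYT.wt T))] at this

/-- The tableaux fall into finitely many classes, indexed by the lower shape `ν` and the upper part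
`U`. On each class `glue` is a bijection from the tableaux of shape `ν` flagged by `min φ m`, and it
multiplies weights by a factor that depends only on `ν` and `U`. -/
theorem flaggedG_eq_sum (lam : YoungDiagram) (φ : ℕ → ℤ) (m : ℤ) :
    flaggedG lam φ = ∑ ν ∈ subdiagrams lam,
      flaggedG ν (fun i => min (φ i) m) * upperSum lam ν m φ := by
  let I : Finset ((_ : YoungDiagram) × Finset Box) :=
    (subdiagrams lam).sigma fun ν => uppers lam ν m φ
  let F : ((_ : YoungDiagram) × Finset Box) → Set (SetSSYT lam) := fun u =>
    {T | T ∈ flagged lam φ ∧ lowerShape T m = u.1 ∧ upperPart T m = u.2}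
  have hF : (⋃ u ∈ I, F u) = flagged lam φ := by
    ext T
    simp only [Set.mem_iUnion, exists_prop]
    constructor
    · rintro ⟨u, -, h⟩
      exact h.1
    · intro h
      refine ⟨⟨lowerShape T m, upperPart T m⟩, Finset.mem_sigma.2 ⟨mem_subdiagrams.2 ?_,
        upperPart_mem_uppers h m⟩, h, rfl, rfl⟩
      rintro ⟨r, c⟩ hp
      exact T.mem_of_mem_entry (mem_lowerShape.1 hp).choose_spec.1
  have hfib : ∀ u ∈ I, HasSum ((fun T : SetSSYT lam => T.wt) ∘ ((↑) : F u → SetSSYT lam))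
      (flaggedG u.1 (fun i => min (φ i) m) *
        (MvPowerSeries.C (β ^ u.1.card * (β⁻¹) ^ lam.card) * ∏ q ∈ u.2, boxWt q)) := by
    rintro ⟨ν, U⟩ hu
    obtain ⟨hν, hU⟩ := Finset.mem_sigma.1 hu
    simp only [mem_subdiagrams] at hν hU
    have hle : ∀ S : flagged ν (fun i => min (φ i) m), ∀ r c, ∀ i ∈ S.1.entry r c, i ≤ m :=
      fun S r c i hi => (S.2 r c i hi).trans (min_le_right _ _)
    let g : flagged ν (fun i => min (φ i) m) → F ⟨ν, U⟩ := fun S =>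
      ⟨glue hν hU S.1 (hle S), by
        refine ⟨?_, lowerShape_glue _ _ _ _, upperPart_glue _ _ _ _⟩
        intro r c i hi
        have : (⟨(r, c), i⟩ : Box) ∈ (glue hν hU S.1 (hle S)).boxes := (SetSSYT.mem_boxes _).2 hi
        rw [boxes_glue, Finset.mem_union] at this
        rcases this with h | h
        · exact (S.2 r c i (S.1.mem_boxes.1 h)).trans (min_le_left _ _)
        · exact (mem_upperBoxes.1 ((mem_uppers.1 hU).1 h)).2.2⟩
    have hg : Function.Bijective g := by
      constructor
      · intro S S' h
        have h1 : (glue hν hU S.1 (hle S)) = glue hν hU S'.1 (hle S') := congrArg Subtype.val h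
        refine Subtype.ext (SetSSYT.ext ?_)
        funext r c
        ext i
        have hi := Finset.ext_iff.1 (congrArg SetSSYT.boxes h1) ⟨(r, c), i⟩
        simp only [boxes_glue, Finset.mem_union, SetSSYT.mem_boxes] at hi
        have hn : i ≤ m → (⟨(r, c), i⟩ : Box) ∉ U := fun him h =>
          absurd him (mem_upperBoxes.1 ((mem_uppers.1 hU).1 h)).2.1.not_ge
        exact ⟨fun h => (hi.1 (Or.inl h)).resolve_right (hn (hle S r c i h)),
          fun h => (hi.2 (Or.inl h)).resolve_right (hn (hle S' r c i h))⟩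
      · rintro ⟨T, hT'⟩
        obtain ⟨hT, h1, h2⟩ := id hT'
        dsimp only at h1 h2
        subst h1 h2
        have hS : lowerPart T m ∈ flagged (lowerShape T m) (fun i => min (φ i) m) := by
          intro r c i hi
          obtain ⟨h1, h2⟩ := Finset.mem_filter.1 hi
          exact le_min (hT r c i h1) h2
        refine ⟨⟨lowerPart T m, hS⟩, Subtype.ext (SetSSYT.boxes_injective ?_)⟩
        exact (boxes_glue hν hU _ (hle ⟨_, hS⟩)).trans (boxes_lowerPart_union_upperPart T m)
    rw [← (Equiv.ofBijective g hg).hasSum_iff]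
    refine ((hasSum_weightSum _).mul_right _).congr_fun ?_
    intro S
    exact wt_glue hν hU S.1 (hle S)
  have hsum := hasSum_sum_disjoint I (fun u _ v _ huv => Set.disjoint_left.2 fun T hT hT' =>
    huv (Sigma.ext (hT.2.1.symm.trans hT'.2.1) (heq_of_eq (hT.2.2.symm.trans hT'.2.2)))) hfib
  rw [hF] at hsum
  refine (hasSum_weightSum _).unique hsum |>.trans ?_
  rw [Finset.sum_sigma]
  refine Finset.sum_congr rfl fun ν _ => ?_
  simp only [upperSum, Finset.mul_sum]

end Topology

/-! ### Coefficients in `R` -/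

theorem X_mem_R (s : ℤ ⊕ ℤ) : (MvPowerSeries.X s : Series) ∈ R :=
  Algebra.subset_adjoin (Or.inl ⟨s, rfl⟩)

theorem inv_one_add_mem_R (s : ℤ ⊕ ℤ) :
    (1 + MvPowerSeries.C β * (MvPowerSeries.X s : Series))⁻¹ ∈ R :=
  Algebra.subset_adjoin (Or.inr ⟨s, rfl⟩)

theorem C_mem_R (k : K) : (MvPowerSeries.C k : Series) ∈ R := R.algebraMap_mem k

theorem one_add_mem_R (s : ℤ ⊕ ℤ) :
    1 + MvPowerSeries.C β * (MvPowerSeries.X s : Series) ∈ R :=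
  R.add_mem R.one_mem (R.mul_mem (C_mem_R _) (X_mem_R s))

theorem one_add_mul_inv (s : ℤ ⊕ ℤ) :
    (1 + MvPowerSeries.C β * (MvPowerSeries.X s : Series)) *
      (1 + MvPowerSeries.C β * (MvPowerSeries.X s : Series))⁻¹ = 1 :=
  MvPowerSeries.mul_inv_cancel _ (by simp)

theorem boxWt_mem_R (q : Box) : boxWt q ∈ R :=
  R.mul_mem (C_mem_R _) (R.mul_mem (R.sub_mem (X_mem_R _) (X_mem_R _)) (inv_one_add_mem_R _))

theorem upperSum_mem_R (lam ν : YoungDiagram) (m : ℤ) (φ : ℕ → ℤ) : upperSum lam ν m φ ∈ R :=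
  R.mul_mem (C_mem_R _) (R.sum_mem fun _ _ => R.prod_mem fun q _ => boxWt_mem_R q)

/-- `1 + β (x ⊖ y) = (1 + β x) / (1 + β y)`, and `R` contains the reciprocal. -/
theorem exists_inv_one_add_boxWt (q : Box) : ∃ v ∈ R, (1 + boxWt q) * v = 1 := by
  let s : ℤ ⊕ ℤ := Sum.inl q.2
  let t : ℤ ⊕ ℤ := Sum.inr (q.2 + (q.1.2 : ℤ) - (q.1.1 : ℤ))
  refine ⟨_, R.mul_mem (one_add_mem_R t) (inv_one_add_mem_R s), ?_⟩
  have h : boxWt q = MvPowerSeries.C β * ((MvPowerSeries.X s - MvPowerSeries.X t) *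
    (1 + MvPowerSeries.C β * (MvPowerSeries.X t : Series))⁻¹) := rfl
  rw [h]
  have hs := one_add_mul_inv s
  have ht := one_add_mul_inv t
  generalize (1 + MvPowerSeries.C β * (MvPowerSeries.X s : Series))⁻¹ = u at *
  generalize (1 + MvPowerSeries.C β * (MvPowerSeries.X t : Series))⁻¹ = v at *
  linear_combination hs + (MvPowerSeries.C β * (MvPowerSeries.X s - MvPowerSeries.X t)) * u * ht

-- When the lower part already fills `lam`, upper boxes can lie only in corners. Distinct corners
-- are never adjacent, so every subset of the allowed corner boxes occurs, and the sum over subsets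
-- factors.
open Classical in
theorem upperSum_self (lam : YoungDiagram) (m : ℤ) (φ : ℕ → ℤ) :
    upperSum lam lam m φ = ∏ q ∈ (upperBoxes lam m φ).filter fun q =>
      (q.1.1, q.1.2 + 1) ∉ lam ∧ (q.1.1 + 1, q.1.2) ∉ lam, (1 + boxWt q) := by
  rw [Finset.prod_one_add, upperSum, ← mul_pow, mul_inv_cancel₀ β_ne_zero, one_pow, map_one,
    one_mul]
  refine Finset.sum_congr (Finset.ext fun U => ?_) fun _ _ => rfl
  rw [mem_uppers, Finset.mem_powerset]
  constructor
  · rintro ⟨h1, h2⟩ q hq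
    exact Finset.mem_filter.2 ⟨h1 hq, h2.right _ _ _ hq, h2.below _ _ _ hq⟩
  · intro h
    have h1 : U ⊆ upperBoxes lam m φ := fun q hq => (Finset.mem_filter.1 (h hq)).1
    have h2 : ∀ r c i, (⟨(r, c), i⟩ : Box) ∈ U → (r, c + 1) ∉ lam ∧ (r + 1, c) ∉ lam :=
      fun r c i hi => (Finset.mem_filter.1 (h hi)).2
    refine ⟨h1, fun r c i j hi hj => ?_, fun r c i j hi hj => ?_, fun p hp hp' => absurd hp hp',
      fun r c i hi => (h2 r c i hi).1, fun r c i hi => (h2 r c i hi).2⟩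
    · exact absurd (mem_upperBoxes.1 (h1 hj)).1 (h2 _ _ _ hi).1
    · exact absurd (mem_upperBoxes.1 (h1 hj)).1 (h2 _ _ _ hi).2

theorem exists_inv_upperSum_self (lam : YoungDiagram) (m : ℤ) (φ : ℕ → ℤ) :
    ∃ v ∈ R, upperSum lam lam m φ * v = 1 := by
  choose v hv hv' using exists_inv_one_add_boxWt
  classical
  rw [upperSum_self]
  exact ⟨_, R.prod_mem fun q _ => hv q, by
    rw [← Finset.prod_mul_distrib]; exact Finset.prod_eq_one fun q _ => hv' q⟩

/-! ### Existence of the expansions -/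

/-- The `R`-module of all finite combinations of the series `G μ`. -/
def GSpan : Submodule R Series := Submodule.span R (Set.range G)

theorem exists_isExpansion_iff {f : Series} : (∃ a, IsExpansion f a) ↔ f ∈ GSpan := by
  rw [GSpan, Finsupp.mem_span_range_iff_exists_finsupp]
  exact exists_congr fun a => eq_comm

theorem mul_mem_GSpan {f c : Series} (hf : f ∈ GSpan) (hc : c ∈ R) : f * c ∈ GSpan := by
  rw [mul_comm]
  exact GSpan.smul_mem ⟨c, hc⟩ hf

theorem flaggedG_zero (lam : YoungDiagram) : flaggedG lam (fun _ => 0) = G lam := rfl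

/-- Cut the tableaux counted by `G lam` at `m`. The term `ν = lam` has an invertible coefficient, so
it can be solved for; the other terms have fewer cells and are covered by induction. -/
theorem flaggedG_const_mem_GSpan {m : ℤ} (hm : m ≤ 0) (lam : YoungDiagram) :
    flaggedG lam (fun _ => m) ∈ GSpan := by
  induction hn : lam.card using Nat.strong_induction_on generalizing lam with
  | _ n ih =>
    have h := flaggedG_eq_sum lam (fun _ => 0) m
    simp only [min_eq_right hm] at h
    have hl : lam ∈ subdiagrams lam := mem_subdiagrams.2 le_rfl
    obtain ⟨v, hv, hv'⟩ := exists_inv_upperSum_self lam m (fun _ => 0)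
    classical
    rw [← Finset.add_sum_erase _ _ hl] at h
    have h2 : flaggedG lam (fun _ => m) = (G lam - ∑ ν ∈ (subdiagrams lam).erase lam,
        flaggedG ν (fun _ => m) * upperSum lam ν m (fun _ => 0)) * v := by
      rw [← flaggedG_zero, h, add_sub_cancel_right, mul_assoc, hv', mul_one]
    rw [h2]
    refine mul_mem_GSpan (GSpan.sub_mem (Submodule.subset_span ⟨lam, rfl⟩)
      (GSpan.sum_mem fun ν hν => mul_mem_GSpan (ih _ ?_ ν rfl) (upperSum_mem_R _ _ _ _))) hv
    obtain ⟨h3, h4⟩ := Finset.mem_erase.1 hν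
    rw [← hn]
    exact Finset.card_lt_card (YoungDiagram.cells_ssubset_iff.2
      (lt_of_le_of_ne (mem_subdiagrams.1 h4) h3))

theorem flaggedG_mem_GSpan (lam : YoungDiagram) {φ : ℕ → ℤ} (hφ : Monotone φ) :
    flaggedG lam φ ∈ GSpan := by
  -- Since `φ 0` is the least entry of the flag, every lower part has a constant flag at this
  -- threshold.
  have h := flaggedG_eq_sum lam φ (min (φ 0) 0)
  have h2 : (fun i => min (φ i) (min (φ 0) 0)) = fun _ => min (φ 0) 0 :=
    funext fun i => min_eq_right ((min_le_left _ _).trans (hφ (Nat.zero_le i)))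
  rw [h2] at h
  rw [h]
  exact GSpan.sum_mem fun ν _ =>
    mul_mem_GSpan (flaggedG_const_mem_GSpan (min_le_right _ _) ν) (upperSum_mem_R _ _ _ _)

/-! ### Elements of `R` involve finitely many variables -/

/-- Needed for uniqueness: it leaves all `x_i` with `i` sufficiently negative free of the
coefficients. -/
theorem exists_support_of_mem_R {c : Series} (hc : c ∈ R) :
    ∃ S : Finset (ℤ ⊕ ℤ), ∀ m, MvPowerSeries.coeff m c ≠ 0 → m.support ⊆ S := by
  classical
  induction hc using Algebra.adjoin_induction with
  | mem f hf =>
    rcases hf with ⟨s, rfl⟩ | ⟨s, rfl⟩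
    · refine ⟨{s}, fun m hm => ?_⟩
      rw [MvPowerSeries.coeff_X] at hm
      obtain rfl : m = Finsupp.single s 1 := by_contra fun h => hm (if_neg h)
      exact Finsupp.support_single_subset
    · refine ⟨{s}, fun m hm => ?_⟩
      -- The inverse is computed in one variable and then renamed, so only powers of `X s` can
      -- occur.
      let e : Unit ↪ ℤ ⊕ ℤ := ⟨fun _ => s, fun _ _ _ => rfl⟩
      let g : MvPowerSeries Unit K := (1 + MvPowerSeries.C β * MvPowerSeries.X ())⁻¹
      have h : (1 + MvPowerSeries.C β * (MvPowerSeries.X s : Series))⁻¹ =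
          MvPowerSeries.rename e g := by
        rw [MvPowerSeries.inv_eq_iff_mul_eq_one (by simp)]
        have h1 : (1 + MvPowerSeries.C β * MvPowerSeries.X () : MvPowerSeries Unit K) * g = 1 :=
          MvPowerSeries.mul_inv_cancel _ (by simp)
        have h2 := congrArg (MvPowerSeries.rename e) h1
        simp only [map_mul, map_add, map_one, MvPowerSeries.rename_C,
          MvPowerSeries.rename_X] at h2
        rw [mul_comm]
        exact h2
      simp only [h] at hm
      have h3 := not_imp_comm.1 (MvPowerSeries.coeff_rename_eq_zero (f := e) g) hm
      obtain ⟨u, rfl⟩ := h3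
      refine Finsupp.mapDomain_support.trans ?_
      exact Finset.image_subset_iff.2 fun _ _ => Finset.mem_singleton_self s
  | algebraMap k =>
    refine ⟨∅, fun m hm => ?_⟩
    change MvPowerSeries.coeff m (MvPowerSeries.C k) ≠ 0 at hm
    rw [MvPowerSeries.coeff_C] at hm
    obtain rfl : m = 0 := by_contra fun h => hm (if_neg h)
    simp
  | add f g _ _ hf hg =>
    obtain ⟨S, hS⟩ := hf
    obtain ⟨S', hS'⟩ := hg
    refine ⟨S ∪ S', fun m hm => ?_⟩
    rw [map_add] at hm
    by_cases h : MvPowerSeries.coeff m f = 0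
    · exact (hS' m fun h' => hm (by rw [h, h', add_zero])).trans Finset.subset_union_right
    · exact (hS m h).trans Finset.subset_union_left
  | mul f g _ _ hf hg =>
    obtain ⟨S, hS⟩ := hf
    obtain ⟨S', hS'⟩ := hg
    refine ⟨S ∪ S', fun m hm => ?_⟩
    rw [MvPowerSeries.coeff_mul] at hm
    obtain ⟨p, hp, hp'⟩ := Finset.exists_ne_zero_of_sum_ne_zero hm
    rw [← Finset.HasAntidiagonal.mem_antidiagonal.1 hp]
    exact Finsupp.support_add.trans (Finset.union_subset_union
      (hS _ (left_ne_zero_of_mul hp')) (hS' _ (right_ne_zero_of_mul hp')))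

/-! ### Coefficients at monomials in the variables `x_i` -/

/-- The inclusion of the variables `x_i`. -/
def xEmb : ℤ ↪ ℤ ⊕ ℤ := ⟨Sum.inl, Sum.inl_injective⟩

/-- The exponent of the monomial in the variables `x_i` that a tableau contributes at `y = 0`. -/
def SetSSYT.content {lam : YoungDiagram} (T : SetSSYT lam) : ℤ →₀ ℕ :=
  ∑ q ∈ T.boxes, Finsupp.single q.2 1

/-- `killCompl xEmb` sets all `y_j` to `0`, and `x ⊖ 0 = x`. The weight of a tableau thus becomes a
single monomial, and pure `x`-coefficients are read off from contents. -/
theorem killCompl_boxWt (q : Box) :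
    MvPowerSeries.killCompl xEmb (boxWt q) = MvPowerSeries.monomial (Finsupp.single q.2 1) β := by
  have hx : MvPowerSeries.killCompl xEmb (x q.2) = (MvPowerSeries.X q.2 : MvPowerSeries ℤ K) :=
    MvPowerSeries.killCompl_X (e := xEmb) q.2
  have hy : ∀ j, MvPowerSeries.killCompl xEmb (y j) = (0 : MvPowerSeries ℤ K) := fun j =>
    MvPowerSeries.killCompl_X_eq_zero (by rintro ⟨i, hi⟩; cases hi)
  have hinv : ∀ j, MvPowerSeries.killCompl xEmb ((1 + MvPowerSeries.C β * y j)⁻¹) =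
      (1 : MvPowerSeries ℤ K) := by
    intro j
    have h := congrArg (MvPowerSeries.killCompl xEmb) (one_add_mul_inv (Sum.inr j))
    change MvPowerSeries.killCompl xEmb ((1 + MvPowerSeries.C β * y j) *
      (1 + MvPowerSeries.C β * y j)⁻¹) = _ at h
    rwa [map_mul, map_add, map_mul, map_one, hy, mul_zero, add_zero, one_mul] at h
  rw [boxWt, ominus, map_mul, map_mul, map_sub, hx, hy, hinv, sub_zero, mul_one,
    MvPowerSeries.killCompl_C, MvPowerSeries.X, ← MvPowerSeries.monomial_zero_eq_C_apply,
    MvPowerSeries.monomial_mul_monomial, zero_add, mul_one]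

theorem killCompl_wt {lam : YoungDiagram} (T : SetSSYT lam) :
    MvPowerSeries.killCompl xEmb T.wt =
      MvPowerSeries.monomial T.content ((β⁻¹) ^ lam.card * β ^ T.boxes.card) := by
  have h : ∀ s : Finset Box, ∏ q ∈ s, MvPowerSeries.killCompl xEmb (boxWt q) =
      MvPowerSeries.monomial (∑ q ∈ s, Finsupp.single q.2 1) (β ^ s.card) := by
    classical
    intro s
    induction s using Finset.induction_on with
    | empty => simp
    | insert q s hq ih =>
      rw [Finset.prod_insert hq, Finset.sum_insert hq, Finset.card_insert_of_notMem hq, ih,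
        killCompl_boxWt, MvPowerSeries.monomial_mul_monomial, pow_succ']
  rw [SetSSYT.wt_eq, map_mul, map_prod, h, MvPowerSeries.killCompl_C,
    ← MvPowerSeries.monomial_zero_eq_C_apply, MvPowerSeries.monomial_mul_monomial, zero_add]
  rfl

theorem coeff_xEmb_wt {lam : YoungDiagram} (T : SetSSYT lam) (n : ℤ →₀ ℕ) [Decidable (n = T.content)] :
    MvPowerSeries.coeff (n.embDomain xEmb) T.wt =
      if n = T.content then (β⁻¹) ^ lam.card * β ^ T.boxes.card else 0 := by
  classical
  rw [← MvPowerSeries.coeff_killCompl, killCompl_wt, MvPowerSeries.coeff_monomial]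
  congr

/-- The content of the tableau of shape `lam` whose row `r` is filled with `v + r`. -/
def rowContent (lam : YoungDiagram) (v : ℤ) : ℤ →₀ ℕ :=
  ∑ p ∈ lam.cells, Finsupp.single (v + (p.1 : ℤ)) 1

/-- The sum of the row numbers, counted from `1`, over the cells of a diagram. -/
def rowSum (lam : YoungDiagram) : ℕ := ∑ p ∈ lam.cells, (p.1 + 1)

theorem rowContent_apply (lam : YoungDiagram) (v : ℤ) (r : ℕ) :
    rowContent lam v (v + r) = lam.rowLen r := by
  classical
  rw [rowContent, Finsupp.finsetSum_apply, YoungDiagram.rowLen_eq_card, YoungDiagram.row,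
    Finset.card_filter]
  refine Finset.sum_congr rfl fun p _ => ?_
  rw [Finsupp.single_apply]
  simp

theorem rowContent_injective (v : ℤ) : Function.Injective fun lam => rowContent lam v := by
  intro lam mu h
  refine YoungDiagram.ext (Finset.ext ?_)
  rintro ⟨r, c⟩
  simp only [YoungDiagram.mem_cells, YoungDiagram.mem_iff_lt_rowLen]
  rw [← rowContent_apply lam v, ← rowContent_apply mu v]
  exact iff_of_eq (congrArg (fun n : ℤ →₀ ℕ => c < n (v + r)) h)

theorem lt_colLen_of_rowContent_ne_zero {lam : YoungDiagram} {v i : ℤ}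
    (h : rowContent lam v i ≠ 0) : v ≤ i ∧ i < v + lam.colLen 0 := by
  rw [rowContent, Finsupp.finsetSum_apply] at h
  obtain ⟨⟨r, c⟩, hp, hp'⟩ := Finset.exists_ne_zero_of_sum_ne_zero h
  obtain rfl : v + (r : ℤ) = i := by
    by_contra hne
    exact hp' (Finsupp.single_eq_of_ne (Ne.symm hne))
  have : r < lam.colLen 0 := YoungDiagram.mem_iff_lt_colLen.1
    (lam.up_left_mem le_rfl (Nat.zero_le c) ((YoungDiagram.mem_cells _).1 hp))
  omega

/-- The tableau of shape `lam` whose row `r` is filled with `v + r`. -/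
def rowTableau (lam : YoungDiagram) (v : ℤ) : SetSSYT lam where
  entry r c := if (r, c) ∈ lam then {v + (r : ℤ)} else ∅
  nonempty_iff r c := by split_ifs with h <;> simp [h]
  row_weak r c i hi j hj := by
    split_ifs at hi hj <;> simp_all
  col_strict r c i hi j hj := by
    split_ifs at hi hj <;> simp_all

theorem rowTableau_boxes (lam : YoungDiagram) (v : ℤ) :
    (rowTableau lam v).boxes = lam.cells.sigma fun p => {v + (p.1 : ℤ)} := by
  ext q
  simp only [SetSSYT.mem_boxes, rowTableau, Finset.mem_sigma, YoungDiagram.mem_cells]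
  split_ifs with h <;> simp [h]

theorem rowTableau_content (lam : YoungDiagram) (v : ℤ) :
    (rowTableau lam v).content = rowContent lam v := by
  rw [SetSSYT.content, rowTableau_boxes, Finset.sum_sigma, rowContent]
  simp

theorem rowTableau_card (lam : YoungDiagram) (v : ℤ) :
    (rowTableau lam v).boxes.card = lam.card := by
  rw [rowTableau_boxes, Finset.card_sigma]
  simp

/-- A tableau whose content is that of the tableau of shape `mu` with constant rows has a shape
with a smaller row sum, unless it is that tableau. -/
theorem eq_of_content_eq {lam mu : YoungDiagram} {v : ℤ} {T : SetSSYT lam}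
    (hT : T.content = rowContent mu v) (hle : rowSum mu ≤ rowSum lam) :
    lam = mu ∧ T = rowTableau lam v := by
  have hv : ∀ r c, ∀ i ∈ T.entry r c, v + r ≤ i := by
    intro r c i hi
    obtain ⟨j, hj, hji⟩ := T.exists_le_of_below (r := 0) r (by rwa [Nat.zero_add])
    have hne : T.content j ≠ 0 := by
      rw [SetSSYT.content, Finsupp.finsetSum_apply]
      refine (Finset.sum_pos' (fun _ _ => Nat.zero_le _)
        ⟨⟨(0, c), j⟩, T.mem_boxes.2 hj, ?_⟩).ne'
      simp
    rw [hT] at hne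
    have := (lt_colLen_of_rowContent_ne_zero hne).1
    omega
  -- Weigh each entry `i` by `i - v + 1`. The content fixes the total as `rowSum mu`, while a cell
  -- of row `r` contributes at least `r + 1`. Hence `rowSum lam ≤ rowSum mu`, and equality forces
  -- the single entry `v + r` in each cell of row `r`.
  let f : ℤ → ℕ := fun i => (i - v + 1).toNat
  have hf : ∀ r : ℕ, f (v + r) = r + 1 := fun r => by simp only [f]; omega
  have hfle : ∀ r c, ∀ i ∈ T.entry r c, r + 1 ≤ f i := fun r c i hi => by
    have := hv r c i hi
    simp only [f]
    omega
  have hsum : ∑ p ∈ lam.cells, ∑ i ∈ T.entry p.1 p.2, f i = rowSum mu := by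
    have h1 := congrArg (Finsupp.linearCombination ℕ f) hT
    rw [SetSSYT.content, rowContent, map_sum, map_sum, SetSSYT.boxes, Finset.sum_sigma] at h1
    simpa [Finsupp.linearCombination_single, hf, rowSum] using h1
  have hcell : ∀ p ∈ lam.cells, p.1 + 1 ≤ ∑ i ∈ T.entry p.1 p.2, f i := by
    rintro ⟨r, c⟩ hp
    obtain ⟨i, hi⟩ := (T.nonempty_iff r c).2 hp
    exact (hfle r c i hi).trans (Finset.single_le_sum (f := f) (fun _ _ => Nat.zero_le _) hi)
  have heq := (Finset.sum_eq_sum_iff_of_le hcell).1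
    (le_antisymm (Finset.sum_le_sum hcell) (by rw [hsum]; exact hle))
  have hT' : T = rowTableau lam v := by
    ext r c i
    simp only [rowTableau]
    split_ifs with h
    · have hone : ∀ i ∈ T.entry r c, i = v + r := by
        intro i hi
        have h1 := Finset.single_le_sum (f := f) (fun _ _ => Nat.zero_le _) hi
        have h2 := heq (r, c) h
        have h3 := hv r c i hi
        simp only [f] at h1 h2
        omega
      obtain ⟨j, hj⟩ := (T.nonempty_iff r c).2 h
      rw [Finset.mem_singleton]
      exact ⟨hone i, fun hi => by rw [hi, ← hone j hj]; exact hj⟩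
    · exact iff_of_false (fun hi => h (T.mem_of_mem_entry hi)) (Finset.notMem_empty _)
  refine ⟨rowContent_injective v ?_, hT'⟩
  change rowContent lam v = rowContent mu v
  rw [← hT, hT', rowTableau_content]

theorem coeff_rowContent_G_of_ne {lam mu : YoungDiagram} (v : ℤ) (hle : rowSum mu ≤ rowSum lam)
    (hne : lam ≠ mu) :
    MvPowerSeries.coeff ((rowContent mu v).embDomain xEmb) (G lam) = 0 := by
  classical
  change (∑ᶠ T ∈ nonPos lam, MvPowerSeries.coeff _ T.wt) = 0
  refine finsum_mem_eq_zero_of_forall_eq_zero fun T _ => ?_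
  rw [coeff_xEmb_wt, if_neg]
  exact fun h => hne (eq_of_content_eq h.symm hle).1

theorem coeff_rowContent_G_self {lam : YoungDiagram} {v : ℤ} (hv : v + lam.colLen 0 ≤ 1) :
    MvPowerSeries.coeff ((rowContent lam v).embDomain xEmb) (G lam) = 1 := by
  classical
  change (∑ᶠ T ∈ nonPos lam, MvPowerSeries.coeff _ T.wt) = 1
  have hmem : rowTableau lam v ∈ nonPos lam := by
    -- The largest entry is `v + lam.colLen 0 - 1`, which `hv` makes non-positive.
    intro r c i hi
    have h := (rowTableau lam v).mem_of_mem_entry hi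
    have h1 : r < lam.colLen 0 := YoungDiagram.mem_iff_lt_colLen.1
      (lam.up_left_mem le_rfl (Nat.zero_le c) h)
    simp only [rowTableau, if_pos h, Finset.mem_singleton] at hi
    omega
  rw [finsum_eq_single _ (rowTableau lam v), finsum_eq_if, if_pos hmem, coeff_xEmb_wt,
    rowTableau_content, if_pos rfl, rowTableau_card, ← mul_pow, inv_mul_cancel₀ β_ne_zero, one_pow]
  intro T hT
  rw [coeff_xEmb_wt, if_neg, finsum_zero]
  exact fun h => hT (eq_of_content_eq h.symm le_rfl).2

/-! ### Uniqueness of the expansions -/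

theorem coeff_add_mul {f g : Series} {m n : (ℤ ⊕ ℤ) →₀ ℕ}
    (h : ∀ p q, MvPowerSeries.coeff p f ≠ 0 → p + q = m + n → p = m) :
    MvPowerSeries.coeff (m + n) (f * g) = MvPowerSeries.coeff m f * MvPowerSeries.coeff n g := by
  rw [MvPowerSeries.coeff_mul]
  refine Finset.sum_eq_single (m, n) ?_ ?_
  · rintro ⟨p, q⟩ hpq hne
    rw [Finset.HasAntidiagonal.mem_antidiagonal] at hpq
    by_contra h0
    obtain rfl := h p q (left_ne_zero_of_mul h0) hpq
    exact hne (Prod.ext rfl (add_left_cancel hpq))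
  · intro hmn
    rw [Finset.HasAntidiagonal.mem_antidiagonal] at hmn
    exact absurd rfl hmn

/-- In a relation, take a monomial `m` minimal under divisibility among those of all coefficients,
then `μ₀` of least `rowSum` among the diagrams in whose coefficient it occurs. At `m` times the row
monomial of `μ₀`, the relation reduces to the coefficient of `m` in `a μ₀`, which is non-zero. -/
theorem linearIndependent_G : LinearIndependent R G := by
  classical
  rw [linearIndependent_iff]
  intro a ha
  by_contra hne
  obtain ⟨μ₁, hμ₁⟩ : ∃ μ, a μ ≠ 0 := not_forall.1 fun h => hne (Finsupp.ext h)
  choose S hS using fun μ => exists_support_of_mem_R (a μ).2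
  -- a bound on the number of rows, and integers below all `i` for which `x_i` occurs
  obtain ⟨L, hL⟩ : ∃ L : ℕ, ∀ μ ∈ a.support, μ.colLen 0 ≤ L :=
    ⟨a.support.sup fun μ => μ.colLen 0, fun μ hμ =>
      Finset.le_sup (f := fun μ : YoungDiagram => μ.colLen 0) hμ⟩
  obtain ⟨w, hw⟩ : ∃ w : ℤ, ∀ μ ∈ a.support, ∀ i, Sum.inl i ∈ S μ → w ≤ i := by
    have hfin : (xEmb ⁻¹' ((a.support.biUnion S : Finset (ℤ ⊕ ℤ)) : Set (ℤ ⊕ ℤ))).Finite :=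
      (Finset.finite_toSet _).preimage xEmb.injective.injOn
    obtain ⟨w, hw⟩ := hfin.bddBelow
    exact ⟨w, fun μ hμ i hi => hw (Finset.mem_coe.2 (Finset.mem_biUnion.2 ⟨μ, hμ, hi⟩))⟩
  -- With at most `L` rows, the entries of these row tableaux are all below `min w 0`: they are
  -- negative and avoid every `x_i` in the coefficients.
  let v : ℤ := min w 0 - L
  -- a monomial of least degree in one of the coefficients
  let D : Set ((ℤ ⊕ ℤ) →₀ ℕ) := {m | ∃ μ, MvPowerSeries.coeff m (a μ : Series) ≠ 0}
  have hD : D.Nonempty := by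
    by_contra h
    refine hμ₁ (Subtype.ext (MvPowerSeries.ext fun m => ?_))
    by_contra h'
    exact h ⟨m, μ₁, h'⟩
  obtain ⟨m, hm, hmin⟩ := exists_minimal_of_wellFoundedLT (· ∈ D) hD
  -- a diagram of least row sum among those for which this monomial occurs
  let E : Finset YoungDiagram :=
    a.support.filter fun μ => MvPowerSeries.coeff m (a μ : Series) ≠ 0
  have hE : E.Nonempty := by
    obtain ⟨μ, hμ⟩ := hm
    refine ⟨μ, Finset.mem_filter.2 ⟨Finsupp.mem_support_iff.2 fun h => hμ ?_, hμ⟩⟩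
    rw [h]; simp
  obtain ⟨μ₀, hμ₀, hμ₀min⟩ := Finset.exists_min_image E rowSum hE
  obtain ⟨hμ₀s, hμ₀c⟩ := Finset.mem_filter.1 hμ₀
  obtain ⟨n, hn_def⟩ : ∃ n, n = (rowContent μ₀ v).embDomain xEmb := ⟨_, rfl⟩
  have hn : ∀ μ ∈ a.support, ∀ s ∈ S μ, n s = 0 := by
    intro μ hμ s hs
    rw [hn_def]
    by_contra h
    have hr : s ∈ Set.range xEmb := by
      by_contra hr
      exact h (Finsupp.embDomain_of_notMem_range _ _ _ hr)
    obtain ⟨i, rfl⟩ := hr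
    simp only [Finsupp.embDomain_apply_self] at h
    have h1 := (lt_colLen_of_rowContent_ne_zero h).2
    have h2 := hw μ hμ i hs
    have h3 := hL μ₀ hμ₀s
    simp only [v] at h1
    omega
  have hcoeff : ∀ μ ∈ a.support, MvPowerSeries.coeff (m + n) ((a μ : Series) * G μ) =
      MvPowerSeries.coeff m (a μ : Series) * MvPowerSeries.coeff n (G μ) := by
    intro μ hμ
    refine coeff_add_mul fun p q hp hadd => ?_
    -- The variables of `p` do not occur in `n`, so `p + q = m + n` bounds `p` by `m`; minimality of
    -- `m` then gives equality.
    have hpm : p ≤ m := by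
      intro s
      by_cases hs : p s = 0
      · rw [hs]; exact Nat.zero_le _
      · have h1 := hn μ hμ s (hS μ p hp (Finsupp.mem_support_iff.2 hs))
        have h2 := DFunLike.congr_fun hadd s
        simp only [Finsupp.add_apply, h1] at h2
        omega
    exact le_antisymm hpm (hmin ⟨μ, hp⟩ hpm)
  have hzero : ∑ μ ∈ a.support,
      MvPowerSeries.coeff m (a μ : Series) * MvPowerSeries.coeff n (G μ) = 0 := by
    rw [← Finset.sum_congr rfl hcoeff, ← map_sum]
    have h1 : ∑ μ ∈ a.support, (a μ : Series) * G μ = 0 := ha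
    rw [h1, map_zero]
  rw [hn_def, Finset.sum_eq_single μ₀] at hzero
  · rw [coeff_rowContent_G_self (by have := hL μ₀ hμ₀s; simp only [v]; omega), mul_one] at hzero
    exact hμ₀c hzero
  · intro μ hμ hμne
    by_cases h : MvPowerSeries.coeff m (a μ : Series) = 0
    · rw [h, zero_mul]
    · rw [coeff_rowContent_G_of_ne v (hμ₀min μ (Finset.mem_filter.2 ⟨hμ, h⟩)) hμne, mul_zero]
  · exact fun h => absurd hμ₀s h

theorem IsExpansion.unique {f : Series} {a b : YoungDiagram →₀ R} (ha : IsExpansion f a)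
    (hb : IsExpansion f b) : a = b :=
  linearIndependent_G (Eq.trans (Eq.symm ha) hb)

/-! ### The factorization of the expansion coefficients -/

theorem existsUnique_isExpansion (lam : YoungDiagram) {φ : ℕ → ℤ} (hφ : Monotone φ) :
    ∃! a, IsExpansion (flaggedG lam φ) a := by
  obtain ⟨a, ha⟩ := exists_isExpansion_iff.2 (flaggedG_mem_GSpan lam hφ)
  exact ⟨a, ha, fun b hb => hb.unique ha⟩

theorem isExpansion_aCoeff (lam : YoungDiagram) {φ : ℕ → ℤ} (hφ : Monotone φ) :
    IsExpansion (flaggedG lam φ) (aCoeff lam φ) := by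
  have h := (existsUnique_isExpansion lam hφ).exists
  rw [aCoeff, dif_pos h]
  exact h.choose_spec

theorem aCoeff_eq {lam : YoungDiagram} {φ : ℕ → ℤ} (hφ : Monotone φ) {a : YoungDiagram →₀ R}
    (ha : IsExpansion (flaggedG lam φ) a) : aCoeff lam φ = a :=
  (isExpansion_aCoeff lam hφ).unique ha

theorem isExpansion_sum {ι : Type*} (s : Finset ι) {f : ι → Series} {a : ι → YoungDiagram →₀ R}
    (h : ∀ i ∈ s, IsExpansion (f i) (a i)) (c : ι → R) :
    IsExpansion (∑ i ∈ s, f i * (c i : Series)) (∑ i ∈ s, c i • a i) := by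
  have key : ∀ a : YoungDiagram →₀ R,
      (a.sum fun μ c => (c : Series) * G μ) = Finsupp.linearCombination R G a := fun _ => rfl
  rw [IsExpansion, key, map_sum]
  refine Finset.sum_congr rfl fun i hi => ?_
  rw [map_smul, ← key, ← h i hi, mul_comm]
  rfl

theorem monotone_flagPos {φ : ℕ → ℤ} (hφ : Monotone φ) : Monotone (flagPos φ) :=
  fun _ _ h => max_le_max_right 0 (hφ h)

theorem monotone_flagNeg {φ : ℕ → ℤ} (hφ : Monotone φ) : Monotone (flagNeg φ) :=
  fun _ _ h => min_le_min_right 0 (hφ h)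

theorem upperSum_flagPos (lam ν : YoungDiagram) (φ : ℕ → ℤ) :
    upperSum lam ν 0 (flagPos φ) = upperSum lam ν 0 φ := by
  have : upperBoxes lam 0 (flagPos φ) = upperBoxes lam 0 φ := by
    ext q
    simp only [mem_upperBoxes, flagPos]
    refine and_congr_right fun _ => and_congr_right fun h => ?_
    rw [le_max_iff, or_iff_left h.not_ge]
  simp only [upperSum, uppers, this]

theorem G_eq_sum_single (μ : YoungDiagram) : IsExpansion (G μ) (Finsupp.single μ 1) := by
  rw [IsExpansion, Finsupp.sum_single_index] <;> simp

/-- Since `φ⁺ ≥ 0`, cutting at `0` leaves the constant flag `0` on the lower part. The splitting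
formula is then itself an expansion in the `G ν`, and uniqueness identifies its coefficients. -/
theorem aCoeff_flagPos {lam ν : YoungDiagram} {φ : ℕ → ℤ} (hφ : Monotone φ)
    (hν : ν ∈ subdiagrams lam) : (aCoeff lam (flagPos φ) ν : Series) = upperSum lam ν 0 φ := by
  classical
  have h := flaggedG_eq_sum lam (flagPos φ) 0
  have h0 : (fun i => min (flagPos φ i) 0) = fun _ => 0 :=
    funext fun i => min_eq_right (le_max_right _ _)
  rw [h0] at h
  have h1 := isExpansion_sum (subdiagrams lam) (fun μ _ => G_eq_sum_single μ)
    fun μ => ⟨_, upperSum_mem_R lam μ 0 (flagPos φ)⟩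
  have h2 := aCoeff_eq (monotone_flagPos hφ) (lam := lam) (h ▸ h1)
  rw [h2, Finsupp.finsetSum_apply, Finset.sum_eq_single ν]
  · simp [upperSum_flagPos]
  · intro μ _ hμ
    simp [hμ]
  · exact fun h => absurd hν h

theorem flaggedG_eq_sum_aCoeff (lam : YoungDiagram) {φ : ℕ → ℤ} (hφ : Monotone φ) :
    flaggedG lam φ =
      ∑ ν ∈ subdiagrams lam, flaggedG ν (flagNeg φ) * (aCoeff lam (flagPos φ) ν : Series) := by
  rw [flaggedG_eq_sum lam φ 0]
  exact Finset.sum_congr rfl fun ν hν => by rw [aCoeff_flagPos hφ hν]; rfl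

theorem aCoeff_eq_sum (lam : YoungDiagram) {φ : ℕ → ℤ} (hφ : Monotone φ) (ρ : YoungDiagram) :
    aCoeff lam φ ρ =
      ∑ ν ∈ subdiagrams lam, aCoeff ν (flagNeg φ) ρ * aCoeff lam (flagPos φ) ν := by
  have h := isExpansion_sum (subdiagrams lam)
    (fun ν _ => isExpansion_aCoeff ν (monotone_flagNeg hφ)) (aCoeff lam (flagPos φ))
  rw [← flaggedG_eq_sum_aCoeff lam hφ] at h
  rw [aCoeff_eq hφ h, Finsupp.finsetSum_apply]
  exact Finset.sum_congr rfl fun ν _ => mul_comm _ _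

theorem jCoeff_eq_sum (lam : YoungDiagram) {φ : ℕ → ℤ} (hφ : Monotone φ) (ρ : YoungDiagram) :
    jCoeff lam φ ρ =
      ∑ ν ∈ subdiagrams lam, jCoeff ν (flagNeg φ) ρ * jCoeff lam (flagPos φ) ν := by
  simp only [jCoeff]
  rw [aCoeff_eq_sum lam hφ]
  simp only [AddSubmonoidClass.coe_finsetSum, MulMemClass.coe_mul, map_sum, map_mul]

/-- Truncation at `0` does not enlarge a non-negative gap, and the right-hand side is positive
because row lengths decrease weakly. -/
theorem Compatible.flagPos {lam : YoungDiagram} {φ : ℕ → ℤ} (h : Compatible lam φ) :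
    Compatible lam (flagPos φ) where
  flag := monotone_flagPos h.flag
  gap i hi := by
    have h1 := h.gap i hi
    have h2 := lam.rowLen_anti i (i + 1) (Nat.le_succ i)
    simp only [BetaGrothendieck.flagPos]
    omega

/-- A diagram that is complementary to the positive part of a tableau contains all rows in which
the flag does not allow positive entries. -/
theorem rowLen_eq_of_upperSum_ne_zero {lam ν : YoungDiagram} {φ : ℕ → ℤ} (hν : ν ≤ lam)
    (h : upperSum lam ν 0 φ ≠ 0) {r : ℕ} (hr : φ r ≤ 0) : ν.rowLen r = lam.rowLen r := by
  obtain ⟨U, hU⟩ : (uppers lam ν 0 φ).Nonempty := by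
    by_contra hn
    rw [upperSum, Finset.not_nonempty_iff_eq_empty.1 hn, Finset.sum_empty, mul_zero] at h
    exact h rfl
  obtain ⟨h1, h2⟩ := mem_uppers.1 hU
  refine eq_of_forall_lt_iff fun c => ?_
  rw [← YoungDiagram.mem_iff_lt_rowLen, ← YoungDiagram.mem_iff_lt_rowLen]
  refine ⟨fun hc => hν hc, fun hc => ?_⟩
  by_contra hc'
  obtain ⟨i, hi⟩ := h2.covers _ hc hc'
  have h3 := (mem_upperBoxes.1 (h1 hi)).2
  simp only at h3
  omega

/-- If `φ i > 0`, then `φ⁻` vanishes at `i` and `i + 1`, so the gap is `0`. If `φ i ≤ 0`, row `i` of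
`ν` is as long as that of `lam` and row `i + 1` no longer, so the bound for `lam` carries over. -/
theorem Compatible.flagNeg {lam ν : YoungDiagram} {φ : ℕ → ℤ} (h : Compatible lam φ)
    (hν : ν ≤ lam) (hne : upperSum lam ν 0 φ ≠ 0) : Compatible ν (flagNeg φ) where
  flag := monotone_flagNeg h.flag
  gap i hi := by
    have hν0 : ν.colLen 0 ≤ lam.colLen 0 := by
      by_contra hlt
      exact absurd (hν (YoungDiagram.mem_iff_lt_colLen.2 (not_le.1 hlt)))
        (by rw [YoungDiagram.mem_iff_lt_colLen]; exact lt_irrefl _)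
    have h1 := h.gap i (hi.trans_le hν0)
    have h2 := ν.rowLen_anti i (i + 1) (Nat.le_succ i)
    have h3 := h.flag (Nat.le_succ i)
    have h4 : ν.rowLen (i + 1) ≤ lam.rowLen (i + 1) := by
      by_contra hlt
      exact absurd (hν (YoungDiagram.mem_iff_lt_rowLen.2 (not_le.1 hlt)))
        (by rw [YoungDiagram.mem_iff_lt_rowLen]; exact lt_irrefl _)
    have h5 : φ i ≤ 0 → ν.rowLen i = lam.rowLen i := rowLen_eq_of_upperSum_ne_zero hν hne
    simp only [Nat.succ_eq_add_one] at h3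
    simp only [BetaGrothendieck.flagNeg]
    omega

end

end BetaGrothendieck

open BetaGrothendieck in
/-- The first four conjuncts say that the notation used in the other three is meaningful: the
flags are compatible with the shapes, and the expansions that define the coefficients exist and
are unique. -/
theorem proposition3 (lam : YoungDiagram) (φ : ℕ → ℤ) (h : Compatible lam φ) :
    (∃! a, IsExpansion (flaggedG lam φ) a) ∧
    Compatible lam (flagPos φ) ∧
    (∃! a, IsExpansion (flaggedG lam (flagPos φ)) a) ∧
    (∀ ν ∈ subdiagrams lam, aCoeff lam (flagPos φ) ν ≠ 0 →
      Compatible ν (flagNeg φ) ∧ ∃! a, IsExpansion (flaggedG ν (flagNeg φ)) a) ∧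
    (flaggedG lam φ =
      ∑ ν ∈ subdiagrams lam, flaggedG ν (flagNeg φ) * (aCoeff lam (flagPos φ) ν : Series)) ∧
    (∀ ρ : YoungDiagram, aCoeff lam φ ρ =
      ∑ ν ∈ subdiagrams lam, aCoeff ν (flagNeg φ) ρ * aCoeff lam (flagPos φ) ν) ∧
    (∀ ρ : YoungDiagram, jCoeff lam φ ρ =
      ∑ ν ∈ subdiagrams lam, jCoeff ν (flagNeg φ) ρ * jCoeff lam (flagPos φ) ν) := by
  refine ⟨existsUnique_isExpansion lam h.flag, h.flagPos,
    existsUnique_isExpansion lam h.flagPos.flag, fun ν hν hne => ?_,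
    flaggedG_eq_sum_aCoeff lam h.flag, aCoeff_eq_sum lam h.flag, jCoeff_eq_sum lam h.flag⟩
  refine ⟨h.flagNeg (mem_subdiagrams.1 hν) fun h0 => hne (Subtype.ext ?_),
    existsUnique_isExpansion ν (monotone_flagNeg h.flag)⟩
  rw [aCoeff_flagPos h.flag hν, h0]
  rfl
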